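/- **Theorem (Overall privacy guarantee of DP-SCP).** *Setting.* A dataset over a record space $A$ is a finite sequence of elements of $A$ of arbitrary length; two datasets are adjacent if one is obtained from the other by adding or removing a single entry. A mechanism $M$ assigns to each dataset $D$ the probability law $M(D)$ of its output on a measurable space. For probability measures $P,Q$ on the same space and $a\in[0,1]$ put $$T(P,Q)(a)=\inf_{\phi}\{\,1-\mathbb E_Q[\phi] : \mathbb E_P[\phi]\le a\,\},$$ the infimum being over all measurable $\phi$ with values in $[0,1]$. For $\mu\ge 0$ let $G_\mu=T(N(0,1),N(\mu,1))$. A mechanism $M$ is $\mu$-GDP if $T(M(D),M(D'))(a)\ge G_\mu(a)$ for all adjacent $D,D'$ and all $a\in[0,1]$. *The DP-SCP pipeline.* Let $\mathcal X,\mathcal Y$ be sets, $\Theta$ a measurable space, and $s:\mathcal X\times\mathcal Y\times\Theta\to\mathbb R$ a score function that is measurable in $\theta$ for each fixed $(x,y)$. Let $M_{\rm train}$ be a mechanism from datasets over $\mathcal X\times\mathcal Y$ to $\Theta$, and let $M_Q$ be a mechanism from datasets over $\mathbb R$ to $\mathbb R$ whose output law depends measurably on its input. On a dataset $D=((X_i,Y_i))_{i=1}^n$,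 DP-SCP draws $\theta\sim M_{\rm train}(D)$; computes on the same dataset the scores $\mathcal S=(s(X_i,Y_i;\theta))_{i=1}^n$; draws, conditionally on $\theta$, $\hat q\sim M_Q(\mathcal S)$; and, at a test point $x\in\mathcal X$, outputs the prediction set $\mathcal C(x)=\{y\in\mathcal Y : s(x,y;\theta)\le\hat q\}$. *Claim.* Let $\mu_{\rm train},\mu_{\rm calib}\ge 0$. Suppose that $M_{\rm train}$ is $\mu_{\rm train}$-GDP and $M_Q$ is $\mu_{\rm calib}$-GDP. Then DP-SCP is $\mu_{\rm total}$-GDP with $$\mu_{\rm total}=\sqrt{\mu_{\rm train}^2+\mu_{\rm calib}^2}.$$ More precisely, the mechanism $D\mapsto(\theta,\hat q)$ is $\mu_{\rm total}$-GDP and, for every test point $x\in\mathcal X$, so is the mechanism $D\mapsto\mathcal C(x)$, for every $\sigma$-algebra on the subsets of $\mathcal Y$ for which $(\theta,q)\mapsto\{y : s(x,y;\theta)\le q\}$ is measurable. -/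

import Mathlib

open MeasureTheory ProbabilityTheory

namespace DPSCP

/-! ### Datasets and add/remove adjacency -/

/-- A dataset: a finite sequence of records, of arbitrary length. -/
abbrev Dataset (A : Type*) : Type _ := Σ n : ℕ, (Fin n → A)

/-- Apply a function to each record of a dataset. -/
def Dataset.map {A B : Type*} (f : A → B) (D : Dataset A) : Dataset B :=
  ⟨D.1, fun i => f (D.2 i)⟩

/-- `D` arises from `D'` by deleting exactly one record. -/
def IsDeletion {A : Type*} (D D' : Dataset A) : Prop :=
  ∃ (n : ℕ) (d : Fin (n + 1) → A) (i : Fin (n + 1)),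
    D' = ⟨n + 1, d⟩ ∧ D = ⟨n, fun j => d (i.succAbove j)⟩

/-- Adjacency: one dataset is obtained from the other by the addition or removal of a
single record. -/
def Adjacent {A : Type*} (D D' : Dataset A) : Prop :=
  IsDeletion D D' ∨ IsDeletion D' D

/-! ### Trade-off functions, `f`-DP and Gaussian DP -/

/-- The trade-off function `T(P, Q)`: the smallest type II error among the randomized measurable
tests of `P` against `Q` whose type I error is at most `a`. -/
noncomputable def tradeoff {Ω : Type*} [MeasurableSpace Ω] (P Q : Measure Ω) (a : ℝ) : ℝ :=
  sInf {b : ℝ | ∃ φ : Ω → ℝ, Measurable φ ∧ (∀ ω, φ ω ∈ Set.Icc (0 : ℝ) 1) ∧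
    ∫ ω, φ ω ∂P ≤ a ∧ b = 1 - ∫ ω, φ ω ∂Q}

/-- `G_μ = T(N(0, 1), N(μ, 1))`. -/
noncomputable def gaussianTradeoff (μ : ℝ) : ℝ → ℝ :=
  tradeoff (gaussianReal 0 1) (gaussianReal μ 1)

/-- A mechanism, given by the law `M D` of its output on each dataset `D`, is `f`-DP. -/
def IsFDP {A Ω : Type*} [MeasurableSpace Ω] (f : ℝ → ℝ) (M : Dataset A → Measure Ω) : Prop :=
  ∀ D D' : Dataset A, Adjacent D D' → ∀ a ∈ Set.Icc (0 : ℝ) 1, f a ≤ tradeoff (M D) (M D') a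

/-- `μ`-Gaussian differential privacy. -/
def IsGDP {A Ω : Type*} [MeasurableSpace Ω] (μ : ℝ) (M : Dataset A → Measure Ω) : Prop :=
  IsFDP (gaussianTradeoff μ) M

/-! ### The DP-SCP pipeline -/

section Pipeline

variable {X Y Θ : Type*} [MeasurableSpace Θ]

/-- The in-sample non-conformity scores `s(X_i, Y_i; θ)`. -/
def scores (s : X → Y → Θ → ℝ) (D : Dataset (X × Y)) (θ : Θ) : Dataset ℝ :=
  D.map fun z => s z.1 z.2 θ

theorem measurable_scores {s : X → Y → Θ → ℝ} (hs : ∀ x y, Measurable (s x y))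
    (D : Dataset (X × Y)) : Measurable (scores s D) := by
  have h1 : Measurable (fun v : Fin D.1 → ℝ => (⟨D.1, v⟩ : Dataset ℝ)) := by
    intro t ht
    exact (MeasurableSpace.measurableSet_iInf.mp ht) D.1
  have h2 : Measurable (fun θ : Θ => fun i : Fin D.1 => s (D.2 i).1 (D.2 i).2 θ) :=
    measurable_pi_lambda _ fun i => hs _ _
  exact h1.comp h2

/-- The law of the private quantities `(θ, q)` released by DP-SCP on the dataset `D`:
`θ` is drawn from `Mtrain D`, then `q` is drawn from `MQ` applied to the scores of the
same dataset under `θ`. -/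
noncomputable def release (Mtrain : Dataset (X × Y) → Measure Θ) (MQ : Kernel (Dataset ℝ) ℝ)
    (s : X → Y → Θ → ℝ) (hs : ∀ x y, Measurable (s x y)) (D : Dataset (X × Y)) :
    Measure (Θ × ℝ) :=
  (Mtrain D) ⊗ₘ (MQ.comap (scores s D) (measurable_scores hs D))

/-- The prediction set `{y : s(x, y; θ) ≤ q}` at the test point `x`. -/
def predictionSet (s : X → Y → Θ → ℝ) (x : X) (p : Θ × ℝ) : Set Y :=
  {y | s x y p.1 ≤ p.2}

/-- The law of the prediction set output by DP-SCP on the dataset `D` at the test point `x`. -/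
noncomputable def output [MeasurableSpace (Set Y)]
    (Mtrain : Dataset (X × Y) → Measure Θ) (MQ : Kernel (Dataset ℝ) ℝ)
    (s : X → Y → Θ → ℝ) (hs : ∀ x y, Measurable (s x y)) (x : X) (D : Dataset (X × Y)) :
    Measure (Set Y) :=
  (release Mtrain MQ s hs D).map (predictionSet s x)

instance (Mtrain : Dataset (X × Y) → Measure Θ) [∀ D, IsProbabilityMeasure (Mtrain D)]
    (MQ : Kernel (Dataset ℝ) ℝ) [IsMarkovKernel MQ]
    (s : X → Y → Θ → ℝ) (hs : ∀ x y, Measurable (s x y)) (D : Dataset (X × Y)) :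
    IsProbabilityMeasure (release Mtrain MQ s hs D) := by
  unfold release; infer_instance

/-- For the product σ-algebra on sets, the prediction set is always measurable. -/
theorem measurable_predictionSet {s : X → Y → Θ → ℝ} (hs : ∀ x y, Measurable (s x y)) (x : X) :
    Measurable (predictionSet s x) :=
  measurable_set_iff.2 fun y =>
    measurableSet_setOfPred.1 (measurableSet_le ((hs x y).comp measurable_fst) measurable_snd)

end Pipeline

end DPSCP

namespace DPSCP

/-! Tests of `P` against `Q` are compared through `TestDominates`, a transitive relation that bounds
trade-off functions and contains every measurable post-processing. For fixed `θ`, the slice of a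
test of `(θ, q)` has some conditional level `α θ`. By `gaussian_neymanPearson`, an explicit Gaussian
test of the same level has at least its power, so `TestDominates.compProd_gaussian` replaces the
kernels by Gaussians. The same lemma replaces the law of `θ`. What remains is a product of two
shifted Gaussians, which `map_rotation_gaussian_prod` turns into one shift of length `√(μ₁ ^ 2 + μ₂
^ 2)` and an uninformative coordinate. -/

/-- A randomized test: a measurable function with values in `[0, 1]`. -/
def IsTest {Ω : Type*} [MeasurableSpace Ω] (φ : Ω → ℝ) : Prop :=
  Measurable φ ∧ ∀ ω, φ ω ∈ Set.Icc (0 : ℝ) 1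

namespace IsTest

variable {Ω Ω' : Type*} [MeasurableSpace Ω] [MeasurableSpace Ω'] {φ : Ω → ℝ}

theorem integrable (hφ : IsTest φ) (P : Measure Ω) [IsFiniteMeasure P] : Integrable φ P :=
  Integrable.of_bound hφ.1.aestronglyMeasurable 1 <| ae_of_all _ fun ω => by
    rw [Real.norm_of_nonneg (hφ.2 ω).1]; exact (hφ.2 ω).2

theorem integral_mem_Icc (hφ : IsTest φ) (P : Measure Ω) [IsProbabilityMeasure P] :
    ∫ ω, φ ω ∂P ∈ Set.Icc (0 : ℝ) 1 := by
  refine ⟨integral_nonneg fun ω => (hφ.2 ω).1, ?_⟩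
  calc ∫ ω, φ ω ∂P ≤ ∫ _, (1 : ℝ) ∂P :=
        integral_mono (hφ.integrable P) (integrable_const 1) fun ω => (hφ.2 ω).2
    _ = 1 := by simp

theorem comp (hφ : IsTest φ) {g : Ω' → Ω} (hg : Measurable g) : IsTest (φ ∘ g) :=
  ⟨hφ.1.comp hg, fun _ => hφ.2 _⟩

theorem indicator {S : Set Ω} (hS : MeasurableSet S) : IsTest (S.indicator fun _ => (1 : ℝ)) :=
  ⟨measurable_const.indicator hS, fun ω => by
    by_cases h : ω ∈ S <;> simp [h]⟩

theorem zero : IsTest (fun _ : Ω => (0 : ℝ)) := ⟨measurable_const, fun _ => by simp⟩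

theorem integral_kernel {φ : Ω × Ω' → ℝ} (hφ : IsTest φ) (κ : Kernel Ω Ω') [IsMarkovKernel κ] :
    IsTest fun ω => ∫ y, φ (ω, y) ∂κ ω :=
  ⟨(hφ.1.stronglyMeasurable.integral_kernel_prod_right' (κ := κ)).measurable, fun ω =>
    IsTest.integral_mem_Icc (hφ.comp measurable_prodMk_left) (κ ω)⟩

end IsTest

section Tradeoff

variable {Ω : Type*} [MeasurableSpace Ω] {P Q : Measure Ω}

theorem tradeoff_le [IsProbabilityMeasure Q] {φ : Ω → ℝ} (hφ : IsTest φ) {a : ℝ}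
    (ha : ∫ ω, φ ω ∂P ≤ a) : tradeoff P Q a ≤ 1 - ∫ ω, φ ω ∂Q := by
  refine csInf_le ⟨0, ?_⟩ ⟨φ, hφ.1, hφ.2, ha, rfl⟩
  rintro b ⟨ψ, hψm, hψ, -, rfl⟩
  exact sub_nonneg.2 (IsTest.integral_mem_Icc ⟨hψm, hψ⟩ Q).2

theorem le_tradeoff {a c : ℝ} (ha : 0 ≤ a)
    (h : ∀ φ : Ω → ℝ, IsTest φ → ∫ ω, φ ω ∂P ≤ a → c ≤ 1 - ∫ ω, φ ω ∂Q) :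
    c ≤ tradeoff P Q a := by
  -- Since `0 ≤ a`, the zero test is admissible and the infimum is not that of the empty set.
  refine le_csInf ⟨_, fun _ => 0, IsTest.zero.1, IsTest.zero.2, by simpa using ha, rfl⟩ ?_
  rintro b ⟨ψ, hψm, hψ, hψa, rfl⟩
  exact h ψ ⟨hψm, hψ⟩ hψa

end Tradeoff

/-- The pair `(P', Q')` is at least as distinguishable as `(P, Q)`: every test of `P` against `Q`
is matched by a test of `P'` against `Q'` that is no larger in level and no smaller in power. -/
def TestDominates {Ω Ω' : Type*} [MeasurableSpace Ω] [MeasurableSpace Ω']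
    (P' Q' : Measure Ω') (P Q : Measure Ω) : Prop :=
  ∀ φ : Ω → ℝ, IsTest φ → ∃ ψ : Ω' → ℝ, IsTest ψ ∧
    ∫ ω, ψ ω ∂P' ≤ ∫ ω, φ ω ∂P ∧ ∫ ω, φ ω ∂Q ≤ ∫ ω, ψ ω ∂Q'

namespace TestDominates

variable {Ω Ω' Ω'' : Type*} [MeasurableSpace Ω] [MeasurableSpace Ω'] [MeasurableSpace Ω'']
  {P Q : Measure Ω} {P' Q' : Measure Ω'} {P'' Q'' : Measure Ω''}

theorem trans (h : TestDominates P'' Q'' P' Q') (h' : TestDominates P' Q' P Q) :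
    TestDominates P'' Q'' P Q := by
  intro φ hφ
  obtain ⟨ψ, hψ, h1, h2⟩ := h' φ hφ
  obtain ⟨χ, hχ, h3, h4⟩ := h ψ hψ
  exact ⟨χ, hχ, h3.trans h1, h2.trans h4⟩

/-- Data processing. -/
theorem map {g : Ω → Ω'} (hg : Measurable g) : TestDominates P Q (P.map g) (Q.map g) := by
  intro φ hφ
  refine ⟨φ ∘ g, hφ.comp hg, ?_, ?_⟩ <;>
    rw [integral_map hg.aemeasurable hφ.1.aestronglyMeasurable] <;> rfl

theorem of_map_eq {g : Ω → Ω'} (hg : Measurable g) (hP : P.map g = P') (hQ : Q.map g = Q') :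
    TestDominates P Q P' Q' :=
  hP ▸ hQ ▸ map hg

/-- An independent component with the same law under both hypotheses carries no information. -/
theorem prod_right [IsProbabilityMeasure P] [IsProbabilityMeasure Q]
    (R : Measure Ω') [IsProbabilityMeasure R] :
    TestDominates P Q (P.prod R) (Q.prod R) := by
  intro φ hφ
  refine ⟨_, hφ.integral_kernel (Kernel.const Ω R), ?_, ?_⟩ <;>
    rw [integral_prod _ (hφ.integrable _)] <;> simp

theorem tradeoff_le [IsProbabilityMeasure Q'] (h : TestDominates P' Q' P Q) {a : ℝ} (ha : 0 ≤ a) :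
    tradeoff P' Q' a ≤ tradeoff P Q a := by
  refine le_tradeoff ha fun φ hφ hφa => ?_
  obtain ⟨ψ, hψ, h1, h2⟩ := h φ hφ
  linarith [DPSCP.tradeoff_le (Q := Q') hψ (h1.trans hφa)]

end TestDominates

/-! ### Explicit one-sided tests of exact level -/

section CDF

variable (P : Measure ℝ)

/-- The rejection region of the level-`a` test with large observations rejected. -/
def upperTail (a : ℝ) : Set ℝ := {x | 1 - a ≤ cdf P x}

theorem measurableSet_upperTail (a : ℝ) : MeasurableSet (upperTail P a) :=
  measurableSet_le measurable_const (monotone_cdf P).measurable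

theorem upperTail_mono {a b : ℝ} (hab : a ≤ b) : upperTail P a ⊆ upperTail P b := fun x hx => by
  simp only [upperTail, Set.mem_ofPred_eq] at hx ⊢; linarith

theorem upperTail_one : upperTail P 1 = Set.univ := by
  ext x; simpa [upperTail] using cdf_nonneg P x

variable [IsProbabilityMeasure P]

theorem continuous_cdf [NullSingletonClass P] : Continuous (cdf P) := by
  refine continuous_iff_continuousAt.2 fun x => ?_
  rw [(monotone_cdf P).continuousAt_iff_leftLim_eq_rightLim, StieltjesFunction.rightLim_eq]
  have h := (cdf P).measure_singleton x
  rw [measure_cdf, measure_singleton, eq_comm, ENNReal.ofReal_eq_zero] at h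
  exact le_antisymm ((monotone_cdf P).leftLim_le le_rfl) (by linarith)

theorem strictMono_cdf [P.IsOpenPosMeasure] : StrictMono (cdf P) := by
  intro x y hxy
  have h := (cdf P).measure_Ioc x y
  rw [measure_cdf] at h
  have h' : 0 < P (Set.Ioc x y) :=
    ((Measure.measure_Ioo_pos P).2 hxy).trans_le (measure_mono Set.Ioo_subset_Ioc_self)
  rw [h, ENNReal.ofReal_pos] at h'
  linarith

theorem exists_cdf_eq [NullSingletonClass P] {a : ℝ} (ha0 : 0 < a) (ha1 : a < 1) :
    ∃ t, cdf P t = a :=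
  mem_range_of_exists_le_of_exists_ge (continuous_cdf P)
    ((tendsto_cdf_atBot P).eventually_le_const ha0).exists
    ((tendsto_cdf_atTop P).eventually_const_le ha1).exists

theorem upperTail_zero [P.IsOpenPosMeasure] : upperTail P 0 = ∅ := by
  ext x
  have := strictMono_cdf P (lt_add_one x)
  simpa [upperTail] using this.trans_le (cdf_le_one P _)

theorem upperTail_eq_Ici [P.IsOpenPosMeasure] {a t : ℝ} (ht : cdf P t = 1 - a) :
    upperTail P a = Set.Ici t := by
  ext x
  simp [upperTail, ← ht, (strictMono_cdf P).le_iff_le]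

/-- Without atoms the cdf takes every value in `(0, 1)`, so the level is attained exactly, with no
randomization at the threshold. -/
theorem measureReal_upperTail [NullSingletonClass P] [P.IsOpenPosMeasure] {a : ℝ}
    (ha : a ∈ Set.Icc (0 : ℝ) 1) : P.real (upperTail P a) = a := by
  rcases ha.1.eq_or_lt with rfl | h0
  · simp [upperTail_zero]
  rcases ha.2.eq_or_lt with rfl | h1
  · simp [upperTail_one]
  obtain ⟨t, ht⟩ := exists_cdf_eq P (a := 1 - a) (by linarith) (by linarith)
  rw [upperTail_eq_Ici P ht, measureReal_congr Ioi_ae_eq_Ici.symm, ← Set.compl_Iic,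
    probReal_compl_eq_one_sub measurableSet_Iic, ← cdf_eq_real, ht]
  ring

end CDF

/-! ### Optimal tests for a Gaussian shift -/

section NeymanPearson

instance (μ : ℝ) : NullSingletonClass (gaussianReal μ 1) :=
  nullSingletonClass_gaussianReal one_ne_zero

instance (μ : ℝ) : (gaussianReal μ 1).IsOpenPosMeasure :=
  (gaussianReal_absolutelyContinuous' μ one_ne_zero).isOpenPosMeasure

/-- Monotone likelihood ratio of the Gaussian location family. -/
theorem gaussianPDFReal_eq_mul_exp (μ x : ℝ) :
    gaussianPDFReal μ 1 x = gaussianPDFReal 0 1 x * Real.exp (μ * x - μ ^ 2 / 2) := by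
  rw [gaussianPDFReal, gaussianPDFReal, mul_assoc (√_)⁻¹, ← Real.exp_add]
  congr 2
  push_cast
  ring

/-- Neyman–Pearson lemma for `N(0, 1)` against `N(μ, 1)`. -/
theorem gaussian_neymanPearson {μ : ℝ} (hμ : 0 ≤ μ) {φ : ℝ → ℝ} (hφ : IsTest φ) :
    ∫ x, φ x ∂gaussianReal μ 1 ≤
      (gaussianReal μ 1).real (upperTail (gaussianReal 0 1) (∫ x, φ x ∂gaussianReal 0 1)) := by
  have ha := hφ.integral_mem_Icc (gaussianReal 0 1)
  set a := ∫ x, φ x ∂gaussianReal 0 1 with ha'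
  -- Levels 0 and 1 correspond to no finite threshold and are treated apart.
  rcases ha.1.eq_or_lt with h0 | h0
  · have h1 : φ =ᵐ[gaussianReal 0 1] 0 :=
      (integral_eq_zero_iff_of_nonneg (fun x => (hφ.2 x).1) (hφ.integrable _)).1
        (ha'.symm.trans h0.symm)
    have h2 : φ =ᵐ[gaussianReal μ 1] 0 :=
      ((gaussianReal_absolutelyContinuous μ one_ne_zero).trans
        (gaussianReal_absolutelyContinuous' 0 one_ne_zero)).ae_eq h1
    rw [integral_congr_ae h2]
    simp
  rcases ha.2.eq_or_lt with h1 | h1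
  · rw [h1, upperTail_one]
    simpa using (hφ.integral_mem_Icc (gaussianReal μ 1)).2
  obtain ⟨t, ht⟩ := exists_cdf_eq (gaussianReal 0 1) (a := 1 - a) (by linarith) (by linarith)
  have hS := measureReal_upperTail (gaussianReal 0 1) ha
  rw [upperTail_eq_Ici _ ht] at hS ⊢
  set ψ : ℝ → ℝ := (Set.Ici t).indicator fun _ => 1
  have hψ : IsTest ψ := IsTest.indicator measurableSet_Ici
  have hψint (m : ℝ) : ∫ x, ψ x ∂gaussianReal m 1 = (gaussianReal m 1).real (Set.Ici t) :=
    integral_indicator_one measurableSet_Ici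
  have hint (m : ℝ) : ∫ x, gaussianPDFReal m 1 x * (ψ x - φ x) =
      (gaussianReal m 1).real (Set.Ici t) - ∫ x, φ x ∂gaussianReal m 1 := by
    rw [← hψint, ← integral_sub (hψ.integrable _) (hφ.integrable _),
      integral_gaussianReal_eq_integral_smul one_ne_zero]
    rfl
  have hable (m : ℝ) : Integrable fun x => gaussianPDFReal m 1 x * (ψ x - φ x) := by
    refine (integrable_gaussianPDFReal m 1).mul_bdd (c := 1)
      (hψ.1.sub hφ.1).aestronglyMeasurable (ae_of_all _ fun x => ?_)
    have := hψ.2 x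
    have := hφ.2 x
    simp only [Set.mem_Icc] at *
    rw [Real.norm_eq_abs, abs_le]
    constructor <;> linarith
  -- The constant is the likelihood ratio at `t`. The ratio is monotone, so its excess over this
  -- constant never has sign opposite to `ψ - φ`. The left side vanishes because `ψ` and `φ` have
  -- equal level.
  have key : ∫ x, Real.exp (μ * t - μ ^ 2 / 2) * (gaussianPDFReal 0 1 x * (ψ x - φ x)) ≤
      ∫ x, gaussianPDFReal μ 1 x * (ψ x - φ x) := by
    refine integral_mono ((hable 0).const_mul _) (hable μ) fun x => ?_
    simp only []
    rw [gaussianPDFReal_eq_mul_exp μ x, ← mul_assoc, mul_comm (Real.exp _), mul_assoc, mul_assoc]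
    refine mul_le_mul_of_nonneg_left ?_ (gaussianPDFReal_nonneg _ _ _)
    rcases le_or_gt t x with hx | hx
    · refine mul_le_mul_of_nonneg_right (Real.exp_le_exp.2 ?_) ?_
      · linarith [mul_le_mul_of_nonneg_left hx hμ]
      · simpa [ψ, hx] using (hφ.2 x).2
    · refine mul_le_mul_of_nonpos_right (Real.exp_le_exp.2 ?_) ?_
      · linarith [mul_le_mul_of_nonneg_left hx.le hμ]
      · simpa [ψ, hx] using (hφ.2 x).1
  rw [integral_const_mul, hint, hint, hS, ← ha', sub_self, mul_zero] at key
  linarith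

theorem one_sub_gaussianTradeoff_le {μ : ℝ} (hμ : 0 ≤ μ) {a : ℝ} (ha : 0 ≤ a) :
    1 - gaussianTradeoff μ a ≤ (gaussianReal μ 1).real (upperTail (gaussianReal 0 1) a) := by
  rw [sub_le_comm]
  refine le_tradeoff ha fun φ hφ hφa => ?_
  have h := gaussian_neymanPearson hμ hφ
  have h' : (gaussianReal μ 1).real _ ≤ (gaussianReal μ 1).real _ :=
    measureReal_mono (upperTail_mono (gaussianReal 0 1) hφa)
  linarith

end NeymanPearson

/-! ### Adaptive composition -/

section Composition

variable {Θ Ω : Type*} [MeasurableSpace Θ] [MeasurableSpace Ω]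

/-- If two kernels are pointwise no more distinguishable than `N(0, 1)` and `N(μ, 1)`, then they
may be replaced by these in a composition. -/
theorem TestDominates.compProd_gaussian {μ : ℝ} (hμ : 0 ≤ μ)
    (P P' : Measure Θ) [IsProbabilityMeasure P] [IsProbabilityMeasure P']
    (κ κ' : Kernel Θ Ω) [IsMarkovKernel κ] [IsMarkovKernel κ']
    (h : ∀ θ, ∀ a ∈ Set.Icc (0 : ℝ) 1, gaussianTradeoff μ a ≤ tradeoff (κ θ) (κ' θ) a) :
    TestDominates (P.prod (gaussianReal 0 1)) (P'.prod (gaussianReal μ 1))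
      (P ⊗ₘ κ) (P' ⊗ₘ κ') := by
  intro φ hφ
  have hα := hφ.integral_kernel κ
  set α : Θ → ℝ := fun θ => ∫ y, φ (θ, y) ∂κ θ
  -- Stating the rejection region through the cdf instead of a quantile makes it jointly measurable
  -- in `θ` and the observation.
  have hS : MeasurableSet {p : Θ × ℝ | p.2 ∈ upperTail (gaussianReal 0 1) (α p.1)} :=
    measurableSet_le (measurable_const.sub (hα.1.comp measurable_fst))
      ((monotone_cdf _).measurable.comp measurable_snd)
  have hψ := IsTest.indicator hS
  have hψint (m θ : _) : ∫ y, Set.indicator {p : Θ × ℝ | p.2 ∈ upperTail (gaussianReal 0 1) (α p.1)}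
      (fun _ => (1 : ℝ)) (θ, y) ∂gaussianReal m 1 =
      (gaussianReal m 1).real (upperTail (gaussianReal 0 1) (α θ)) :=
    integral_indicator_one (s := upperTail (gaussianReal 0 1) (α θ)) (measurableSet_upperTail _ _)
  refine ⟨_, hψ, ?_, ?_⟩
  · rw [integral_prod _ (hψ.integrable _), Measure.integral_compProd (hφ.integrable _)]
    refine (integral_congr_ae <| ae_of_all _ fun θ => ?_).le
    simp only [hψint]
    exact measureReal_upperTail _ (hα.2 θ)
  · rw [integral_prod _ (hψ.integrable _), Measure.integral_compProd (hφ.integrable _)]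
    refine integral_mono ((hφ.integral_kernel κ').integrable P')
      (hψ.integrable _).integral_prod_left fun θ => ?_
    simp only [hψint]
    have h1 := h θ (α θ) (hα.2 θ)
    have h2 := DPSCP.tradeoff_le (Q := κ' θ) (hφ.comp (measurable_prodMk_left (x := θ)))
      (le_refl (α θ))
    have h3 := one_sub_gaussianTradeoff_le hμ (hα.2 θ).1
    simp only [Function.comp_apply] at h2
    linarith

/-- A rotation of the plane maps the standard Gaussian law shifted along the first axis to the
standard Gaussian law shifted by the rotated vector. -/
theorem map_rotation_gaussian_prod (m θ : ℝ) :
    ((gaussianReal m 1).prod (gaussianReal 0 1)).map (ContinuousLinearMap.rotation θ) =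
      (gaussianReal (m * Real.cos θ) 1).prod (gaussianReal (-(m * Real.sin θ)) 1) := by
  have hchar (m : ℝ) (L : StrongDual ℝ ℝ) : charFunDual (gaussianReal m 1) L =
      Complex.exp (m * L 1 * Complex.I - L 1 ^ 2 / 2) := by
    have hL : L m = m * L 1 := by simpa using L.map_smul m 1
    rw [charFunDual_eq_charFun_map_one, gaussianReal_map_continuousLinearMap,
      charFun_gaussianReal, hL]
    simp [max_eq_left (sq_nonneg (L 1))]
  refine Measure.ext_of_charFunDual (funext fun L => ?_)
  have hL (x y : ℝ) : L (x, y) = x * L (1, 0) + y * L (0, 1) := by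
    rw [← smul_eq_mul, ← smul_eq_mul, ← map_smul, ← map_smul, ← map_add]
    simp
  simp only [charFunDual_map, charFunDual_prod, hchar, ← Complex.exp_add,
    ContinuousLinearMap.comp_apply, ContinuousLinearMap.inl_apply, ContinuousLinearMap.inr_apply,
    ContinuousLinearMap.rotation_apply]
  rw [hL (_ + _), hL (_ + _)]
  congr 1
  push_cast
  simp only [smul_eq_mul, mul_one, mul_zero, add_zero, zero_add, Complex.ofReal_cos,
    Complex.ofReal_sin, Complex.ofReal_neg, Complex.ofReal_zero]
  -- The linear terms agree; the quadratic terms differ only by the factor `sin² + cos²`.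
  linear_combination (-((L (1, 0) : ℂ) ^ 2 + (L (0, 1) : ℂ) ^ 2) / 2) *
    Complex.sin_sq_add_cos_sq (θ : ℂ)

theorem TestDominates.gaussian_prod (μ₁ μ₂ : ℝ) :
    TestDominates (gaussianReal 0 1) (gaussianReal (√(μ₁ ^ 2 + μ₂ ^ 2)) 1)
      ((gaussianReal 0 1).prod (gaussianReal 0 1))
      ((gaussianReal μ₁ 1).prod (gaussianReal μ₂ 1)) := by
  set z : ℂ := ⟨μ₁, μ₂⟩
  have hz : ‖z‖ = √(μ₁ ^ 2 + μ₂ ^ 2) := by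
    rw [Complex.norm_def, Complex.normSq_mk, sq, sq]
  rw [← hz]
  -- The rotation is clockwise, so the angle `-z.arg` carries `(‖z‖, 0)` to `(μ₁, μ₂)`.
  refine (TestDominates.prod_right (gaussianReal 0 1)).trans <|
    TestDominates.of_map_eq (ContinuousLinearMap.rotation (-z.arg)).continuous.measurable ?_ ?_
  · rw [map_rotation_gaussian_prod]; simp
  · rw [map_rotation_gaussian_prod, Real.cos_neg, Real.sin_neg, mul_neg, neg_neg,
      Complex.norm_mul_cos_arg, Complex.norm_mul_sin_arg]

/-- Adaptive composition of two Gaussian trade-off bounds. -/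
theorem TestDominates.compProd_of_gaussianTradeoff_le {μ₁ μ₂ : ℝ} (hμ₁ : 0 ≤ μ₁) (hμ₂ : 0 ≤ μ₂)
    (P P' : Measure Θ) [IsProbabilityMeasure P] [IsProbabilityMeasure P']
    (κ κ' : Kernel Θ Ω) [IsMarkovKernel κ] [IsMarkovKernel κ']
    (hP : ∀ a ∈ Set.Icc (0 : ℝ) 1, gaussianTradeoff μ₁ a ≤ tradeoff P P' a)
    (hκ : ∀ θ, ∀ a ∈ Set.Icc (0 : ℝ) 1, gaussianTradeoff μ₂ a ≤ tradeoff (κ θ) (κ' θ) a) :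
    TestDominates (gaussianReal 0 1) (gaussianReal (√(μ₁ ^ 2 + μ₂ ^ 2)) 1)
      (P ⊗ₘ κ) (P' ⊗ₘ κ') := by
  -- Viewed as constant kernels over a Gaussian coordinate, `P` and `P'` fall under the same
  -- replacement lemma; the coordinates are then swapped.
  have h1 := TestDominates.compProd_gaussian hμ₁ (gaussianReal 0 1) (gaussianReal μ₂ 1)
    (Kernel.const ℝ P) (Kernel.const ℝ P') (fun _ => by simpa using hP)
  rw [Measure.compProd_const, Measure.compProd_const] at h1
  have hswap : TestDominates ((gaussianReal 0 1).prod P) ((gaussianReal μ₂ 1).prod P')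
      (P.prod (gaussianReal 0 1)) (P'.prod (gaussianReal μ₂ 1)) :=
    TestDominates.of_map_eq measurable_swap Measure.prod_swap Measure.prod_swap
  have h2 := TestDominates.gaussian_prod μ₂ μ₁
  rw [add_comm (μ₂ ^ 2)] at h2
  exact ((h2.trans h1).trans hswap).trans
    (TestDominates.compProd_gaussian hμ₂ P P' κ κ' hκ)

end Composition

/-- For fixed `θ` the scores are computed record by record, so this transfers adjacency to the input
of `MQ`. -/
theorem Adjacent.map {A B : Type*} (f : A → B) {D D' : Dataset A} (h : Adjacent D D') :
    Adjacent (D.map f) (D'.map f) := by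
  have key {D D' : Dataset A} : IsDeletion D D' → IsDeletion (D.map f) (D'.map f) := by
    rintro ⟨n, d, i, rfl, rfl⟩
    exact ⟨n, fun j => f (d j), i, rfl, rfl⟩
  exact h.imp key key

end DPSCP

theorem mainTheorem6 {X Y Θ : Type*} [MeasurableSpace Θ]
    (s : X → Y → Θ → ℝ) (hs : ∀ x y, Measurable (s x y))
    (Mtrain : DPSCP.Dataset (X × Y) → Measure Θ) [∀ D, IsProbabilityMeasure (Mtrain D)]
    (MQ : Kernel (DPSCP.Dataset ℝ) ℝ) [IsMarkovKernel MQ]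
    (μtrain μcalib : ℝ) (hμtrain : 0 ≤ μtrain) (hμcalib : 0 ≤ μcalib)
    (htrain : DPSCP.IsGDP μtrain Mtrain)
    (hcalib : DPSCP.IsGDP μcalib (fun S => MQ S)) :
    DPSCP.IsGDP (√(μtrain ^ 2 + μcalib ^ 2)) (DPSCP.release Mtrain MQ s hs) ∧
    ∀ (x : X) (mSet : MeasurableSpace (Set Y)),
      Measurable[_, mSet] (DPSCP.predictionSet s x) →
        DPSCP.IsGDP (√(μtrain ^ 2 + μcalib ^ 2))
          (DPSCP.output Mtrain MQ s hs x) := by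
  have key (D D' : DPSCP.Dataset (X × Y)) (h : DPSCP.Adjacent D D') :
      DPSCP.TestDominates (gaussianReal 0 1) (gaussianReal (√(μtrain ^ 2 + μcalib ^ 2)) 1)
        (DPSCP.release Mtrain MQ s hs D) (DPSCP.release Mtrain MQ s hs D') :=
    DPSCP.TestDominates.compProd_of_gaussianTradeoff_le hμtrain hμcalib _ _ _ _
      (htrain D D' h) fun θ a ha => by
        simpa only [Kernel.comap_apply] using!
          hcalib _ _ (h.map fun z => s z.1 z.2 θ) a ha
  exact ⟨fun D D' h a ha => (key D D' h).tradeoff_le ha.1, fun x mSet hx D D' h a ha =>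
    ((key D D' h).trans (DPSCP.TestDominates.map hx)).tradeoff_le ha.1⟩
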